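/- **Setting.** Let $d,e\ge 1$ be integers, $T>0$, and $\alpha,\beta\in(0,1]$ with $\alpha+\beta>1$. Let $\mathcal M_{e,d}\cong\mathbb R^{ed}$ be the space of real $e\times d$ matrices with its Euclidean (Frobenius) structure, and for a Euclidean space $E$ let $\mathrm{cc}(E)$ be the set of nonempty convex compact subsets of $E$. Let $w:[0,T]\to\mathbb R^d$ be $\beta$-Hölder continuous, and let $F:[0,T]\to\mathrm{cc}(\mathcal M_{e,d})$ be $\alpha$-Hölder continuous for the Hausdorff distance $d_H$, with Hölder seminorm $\|F\|_{\alpha,T}=\sup_{0\le s<t\le T} d_H(F(s),F(t))/|t-s|^\alpha$. For $C\in\mathrm{cc}(E)$ and $\ell\in E$ put $Y(\ell,C)=\{c\in C:\langle \ell,c\rangle=\max_{x\in C}\langle \ell,x\rangle\}$, let $\mathcal T_C$ be the set of $\ell$ for which $Y(\ell,C)$ consists of a single point, and denote this point by $y(\ell,C)$. The Demyanov distance is $d_D(A,B)=\sup\{\|y(\ell,A)-y(\ell,B)\|:\ell\in\mathcal T_A\cap\mathcal T_B\}$, and $\|F\|_{\alpha,T,D}=\sup_{0\le s<t\le T} d_D(F(s),F(t))/|t-s|^\alpha\in[0,\infty]$.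 The Steiner point of $C$ is $\mathrm{St}(C)=\frac1{v}\int_{\mathcal T_C\cap B(0,1)}y(x,C)\,dx$, where $v$ is the volume of the unit ball $B(0,1)$ of $E$. Let $\kappa_{ed}$ be the smallest Lipschitz constant of $\mathrm{St}:(\mathrm{cc}(\mathcal M_{e,d}),d_H)\to\mathcal M_{e,d}$, and $$r_{\min}=\min\{\kappa_{ed}\,\|F\|_{\alpha,T},\ \|F\|_{\alpha,T,D}\}.$$ For $r\ge 0$ let $\mathcal S_{\alpha,r}(F)$ be the set of measurable $f:[0,T]\to\mathcal M_{e,d}$ with $f(t)\in F(t)$ for all $t\in[0,T]$ and $\|f(t)-f(s)\|\le r|t-s|^\alpha$ for all $s,t\in[0,T]$. The Young integral $\int_0^T f\,dw$ is the limit of the sums $\sum_k f(t_k)(w(t_{k+1})-w(t_k))$ over dissections $0=t_0<\dots<t_n=T$ as the mesh $\max_k (t_{k+1}-t_k)$ tends to $0$. The Aumann–Young integral is $$J_{T,\alpha,r}(F,w)=\Big\{\int_0^T f(t)\,dw(t)\ :\ f\in\mathcal S_{\alpha,r}(F)\Big\}.$$ **Proposition.** For every real $r\ge r_{\min}$, the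 Young integral $\int_0^T f\,dw$ exists for every $f\in\mathcal S_{\alpha,r}(F)$, and $J_{T,\alpha,r}(F,w)$ is a nonempty, bounded, closed and convex subset of $\mathbb R^e$. -/

import Mathlib

open Set Filter Topology MeasureTheory
open scoped NNReal ENNReal Matrix

noncomputable section

namespace AumannYoung

section ConvexGeometry

variable {E : Type*} [NormedAddCommGroup E] [InnerProductSpace ℝ E]

/- `ConvexBody E` is Mathlib's type of nonempty compact convex subsets of `E`
(no interior point is required); its metric is the Hausdorff distance. -/

/-- The support function `δ*(ℓ, C) = max_{x ∈ C} ⟨ℓ, x⟩`. -/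
def supportFun (l : E) (C : ConvexBody E) : ℝ :=
  sSup ((fun x : E => inner ℝ l x) '' (C : Set E))

/-- The face `Y(ℓ, C)` of all points of `C` at which `⟨ℓ, ·⟩` is maximal. -/
def exposedFace (l : E) (C : ConvexBody E) : Set E :=
  {c : E | c ∈ C ∧ inner ℝ l c = supportFun l C}

/-- The set `𝒯_C` of exposing directions: those `ℓ` for which `Y(ℓ, C)` is a singleton. -/
def exposingDirections (C : ConvexBody E) : Set E :=
  {l : E | ∃ c : E, exposedFace l C = {c}}

open Classical in
/-- For `ℓ ∈ 𝒯_C`, the exposed point `y(ℓ, C)`, i.e. the unique element of `Y(ℓ, C)`.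
It is only used for exposing directions. -/
def exposedPoint (l : E) (C : ConvexBody E) : E :=
  if h : ∃ c : E, exposedFace l C = {c} then h.choose else 0

/-- The Demyanov distance. -/
def demyanovDist (A B : ConvexBody E) : ℝ≥0∞ :=
  ⨆ l ∈ exposingDirections A ∩ exposingDirections B,
    edist (exposedPoint l A) (exposedPoint l B)

end ConvexGeometry

section Steiner

variable {E : Type*} [NormedAddCommGroup E] [InnerProductSpace ℝ E] [FiniteDimensional ℝ E]
  [MeasurableSpace E] [BorelSpace E]

/-- The Steiner point: the integral of `y(x, C)` over the exposing directions `x` in the unit ball,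
divided by the volume of the unit ball. -/
def steinerPoint (C : ConvexBody E) : E :=
  (volume.real (Metric.ball (0 : E) 1))⁻¹ •
    ∫ x in exposingDirections C ∩ Metric.ball (0 : E) 1, exposedPoint x C

variable (E) in
/-- The sharp Lipschitz constant of the Steiner point with respect to the Hausdorff distance. -/
def steinerLip : ℝ≥0∞ :=
  ⨅ (K : ℝ≥0) (_ : LipschitzWith K (steinerPoint : ConvexBody E → E)), (K : ℝ≥0∞)

end Steiner

/-- The `α`-Hölder seminorm of a multifunction with respect to the Demyanov distance,
with values in `[0, ∞]`. -/
def demyanovHolderSeminorm {E : Type*} [NormedAddCommGroup E] [InnerProductSpace ℝ E]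
    {T : ℝ} (α : ℝ≥0) (F : Icc (0 : ℝ) T → ConvexBody E) : ℝ≥0∞ :=
  ⨆ (s : Icc (0 : ℝ) T) (t : Icc (0 : ℝ) T) (_ : s < t),
    demyanovDist (F s) (F t) / ENNReal.ofReal (((t : ℝ) - (s : ℝ)) ^ (α : ℝ))

/-- Real matrices with `e` rows and `d` columns, with the Euclidean (Frobenius) inner product
and norm of `ℝ^{ed}`. -/
abbrev Mat (e d : ℕ) : Type := EuclideanSpace ℝ (Fin e × Fin d)

/-- The matrix-vector product. -/
def Mat.apply {e d : ℕ} (A : Mat e d) (v : EuclideanSpace ℝ (Fin d)) :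
    EuclideanSpace ℝ (Fin e) :=
  WithLp.toLp 2 ((Matrix.of fun i j => A (i, j)) *ᵥ (WithLp.ofLp v))

/-- Dissections `0 = t₀ < t₁ < ⋯ < tₙ = T` of `[0, T]`. -/
structure Dissection (T : ℝ) where
  n : ℕ
  pts : Fin (n + 1) → Icc (0 : ℝ) T
  strictMono : StrictMono pts
  first : (pts 0 : ℝ) = 0
  last : (pts (Fin.last n) : ℝ) = T

/-- The mesh of a dissection. -/
def Dissection.mesh {T : ℝ} (D : Dissection T) : ℝ :=
  ⨆ k : Fin D.n, ((D.pts k.succ : ℝ) - (D.pts k.castSucc : ℝ))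

/-- Convergence along dissections whose mesh tends to `0`. -/
def meshFilter (T : ℝ) : Filter (Dissection T) :=
  comap Dissection.mesh (𝓝 0)

/-- The left-point Riemann sum `∑ f(t_k) (w(t_{k+1}) - w(t_k))`. -/
def riemannSum {e d : ℕ} {T : ℝ} (f : Icc (0 : ℝ) T → Mat e d)
    (w : Icc (0 : ℝ) T → EuclideanSpace ℝ (Fin d)) (D : Dissection T) :
    EuclideanSpace ℝ (Fin e) :=
  ∑ k : Fin D.n, (f (D.pts k.castSucc)).apply (w (D.pts k.succ) - w (D.pts k.castSucc))

/-- The Young integral `∫₀ᵀ f dw`, the limit of the Riemann sums as the mesh tends to `0`. -/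
def youngIntegral {e d : ℕ} {T : ℝ} (f : Icc (0 : ℝ) T → Mat e d)
    (w : Icc (0 : ℝ) T → EuclideanSpace ℝ (Fin d)) : EuclideanSpace ℝ (Fin e) :=
  limUnder (meshFilter T) (riemannSum f w)

/-- `r_min = min (κ_{ed} ‖F‖_{α,T}, ‖F‖_{α,T,Dem})`, where `‖F‖_{α,T,Dem}` may be `∞`. -/
def rMin {e d : ℕ} {T : ℝ} (α : ℝ≥0) (F : Icc (0 : ℝ) T → ConvexBody (Mat e d)) : ℝ≥0∞ :=
  min (steinerLip (Mat e d) * eHolderNorm α F) (demyanovHolderSeminorm α F)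

/-- The measurable selections of `F` with `α`-Hölder seminorm at most `r`. -/
def selections {e d : ℕ} {T : ℝ} (α r : ℝ≥0) (F : Icc (0 : ℝ) T → ConvexBody (Mat e d)) :
    Set (Icc (0 : ℝ) T → Mat e d) :=
  {f | Measurable f ∧ (∀ t, f t ∈ F t) ∧ eHolderNorm α f ≤ (r : ℝ≥0∞)}

/-- The Aumann–Young integral `J_{T,α,r}(F, w)`. -/
def aumannYoungIntegral {e d : ℕ} {T : ℝ} (α r : ℝ≥0)
    (F : Icc (0 : ℝ) T → ConvexBody (Mat e d))
    (w : Icc (0 : ℝ) T → EuclideanSpace ℝ (Fin d)) : Set (EuclideanSpace ℝ (Fin e)) :=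
  {j | ∃ f ∈ selections α r F, j = youngIntegral f w}

end AumannYoung

end

/-! The Aumann–Young integral is the image of the set of selections under `f ↦ ∫ f dw`, so
everything reduces to that set and that map. The set is convex, and it is compact for pointwise
convergence: by Tychonoff the product of the `F t` is compact, and the Hölder bound is a closed
condition (`isCompact_selections`). It contains `t ↦ St (F t)`: by Rademacher almost every direction
exposes a point, so `St C` is an average of points of `C` and inherits both the Demyanov bound and
the Hausdorff bound (`holderWith_steinerPoint`). For the map, a sewing estimate bounds the error of
a Riemann sum by a constant times `mesh ^ (α + β - 1)`. The constant depends on `f` only through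
`r`, so the integral is a uniform limit, over all selections, of Riemann sums that are continuous
for pointwise convergence (`continuousOn_youngIntegral`). The image of the compact set is therefore
compact, and linearity makes it convex. -/

namespace AumannYoung

/-! ### Support functions and exposed points. -/

section SupportFunction

variable {E : Type*} [NormedAddCommGroup E] [InnerProductSpace ℝ E]

theorem isCompact_image_inner (l : E) (C : ConvexBody E) :
    IsCompact ((fun x : E => inner ℝ l x) '' (C : Set E)) :=
  C.isCompact.image (by fun_prop)

theorem inner_le_supportFun (l : E) {C : ConvexBody E} {x : E} (hx : x ∈ C) :
    inner ℝ l x ≤ supportFun l C :=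
  le_csSup (isCompact_image_inner l C).bddAbove ⟨x, hx, rfl⟩

theorem exposedFace_nonempty (l : E) (C : ConvexBody E) : (exposedFace l C).Nonempty := by
  obtain ⟨x, hx, h⟩ := (isCompact_image_inner l C).sSup_mem (C.nonempty.image _)
  exact ⟨x, hx, h⟩

theorem exists_lipschitzWith_supportFun (C : ConvexBody E) :
    ∃ K : ℝ≥0, LipschitzWith K fun l => supportFun l C := by
  obtain ⟨R, hR⟩ := C.isCompact.isBounded.exists_norm_le
  refine ⟨R.toNNReal, LipschitzWith.of_le_add_mul _ fun l m => ?_⟩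
  obtain ⟨c, hc, hl⟩ := exposedFace_nonempty l C
  have h1 : inner ℝ l c = inner ℝ m c + inner ℝ (l - m) c := by rw [inner_sub_left]; ring
  have h2 : inner ℝ (l - m) c ≤ R * ‖l - m‖ :=
    (real_inner_le_norm _ _).trans (by
      rw [mul_comm]; exact mul_le_mul_of_nonneg_right (hR c hc) (norm_nonneg _))
  have h3 : R * ‖l - m‖ ≤ R.toNNReal * dist l m := by
    rw [dist_eq_norm]
    exact mul_le_mul_of_nonneg_right (Real.le_coe_toNNReal R) (norm_nonneg _)
  rw [← hl]
  linarith [inner_le_supportFun m hc]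

/-- If `c` lies in the face, `x ↦ supportFun x C - ⟨c, x⟩` is nonnegative and vanishes at `l`. Its
derivative there is zero, which forces `c` to be the gradient. -/
theorem exposedFace_eq_of_differentiableAt [CompleteSpace E] {l : E} {C : ConvexBody E}
    (h : DifferentiableAt ℝ (fun l => supportFun l C) l) :
    exposedFace l C = {gradient (fun l => supportFun l C) l} := by
  refine (exposedFace_nonempty l C).subset_singleton_iff.mp fun c hc => ?_
  have hmin : IsLocalMin (fun x => supportFun x C - inner ℝ c x) l := by
    refine Eventually.of_forall fun x => ?_
    have := inner_le_supportFun x hc.1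
    have h2 := hc.2
    rw [real_inner_comm] at this h2
    linarith
  have hd := h.hasFDerivAt.sub (innerSL ℝ c).hasFDerivAt
  have hz := hmin.hasFDerivAt_eq_zero hd
  have hf := sub_eq_zero.mp hz
  rw [mem_singleton_iff, gradient, hf, eq_comm, LinearIsometryEquiv.symm_apply_eq]
  rfl

theorem exposedPoint_eq {l c : E} {C : ConvexBody E} (h : exposedFace l C = {c}) :
    exposedPoint l C = c := by
  have h' : ∃ c : E, exposedFace l C = {c} := ⟨c, h⟩
  rw [exposedPoint, dif_pos h']
  exact singleton_injective (h'.choose_spec.symm.trans h)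

theorem exposedPoint_mem {l : E} {C : ConvexBody E} (h : l ∈ exposingDirections C) :
    exposedPoint l C ∈ C := by
  obtain ⟨c, hc⟩ := h
  rw [exposedPoint_eq hc]
  exact (hc.symm ▸ mem_singleton c : c ∈ exposedFace l C).1

end SupportFunction

/-! ### The Steiner point as an average, and its continuity bounds. -/

section SteinerPoint

variable {E : Type*} [NormedAddCommGroup E] [InnerProductSpace ℝ E] [FiniteDimensional ℝ E]
  [MeasurableSpace E] [BorelSpace E]

/-- Rademacher's theorem for the Lipschitz support function. The gradient then serves as a Borel
version of the exposed point. -/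
theorem ae_mem_exposingDirections_and_eq_gradient (C : ConvexBody E) :
    ∀ᵐ l : E, l ∈ exposingDirections C ∧
      exposedPoint l C = gradient (fun l => supportFun l C) l := by
  obtain ⟨K, hK⟩ := exists_lipschitzWith_supportFun C
  filter_upwards [hK.ae_differentiableAt (μ := volume)] with l hl
  have := exposedFace_eq_of_differentiableAt hl
  exact ⟨⟨_, this⟩, exposedPoint_eq this⟩

theorem aestronglyMeasurable_exposedPoint (C : ConvexBody E) :
    AEStronglyMeasurable (fun l => exposedPoint l C) (volume : Measure E) := by
  have hm : Measurable (gradient fun l => supportFun l C) :=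
    (InnerProductSpace.toDual ℝ E).symm.continuous.measurable.comp (measurable_fderiv ℝ _)
  refine hm.aestronglyMeasurable.congr ?_
  filter_upwards [ae_mem_exposingDirections_and_eq_gradient C] with l hl using hl.2.symm

theorem integrableOn_exposedPoint (C : ConvexBody E) :
    IntegrableOn (fun l => exposedPoint l C) (Metric.ball (0 : E) 1) := by
  obtain ⟨R, hR⟩ := C.isCompact.isBounded.exists_norm_le
  refine Measure.integrableOn_of_bounded (M := R) measure_ball_lt_top.ne
    (aestronglyMeasurable_exposedPoint C) (ae_restrict_of_ae ?_)
  filter_upwards [ae_mem_exposingDirections_and_eq_gradient C] with l hl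
  exact hR _ (exposedPoint_mem hl.1)

theorem steinerPoint_eq_average (C : ConvexBody E) :
    steinerPoint C = ⨍ x in Metric.ball (0 : E) 1, exposedPoint x C := by
  rw [steinerPoint, setAverage_eq]
  congr 1
  refine setIntegral_congr_set ?_
  filter_upwards [ae_mem_exposingDirections_and_eq_gradient C] with l hl
  exact propext ⟨fun h => h.2, fun h => ⟨hl.1, h⟩⟩

theorem steinerPoint_mem (C : ConvexBody E) : steinerPoint C ∈ C := by
  rw [steinerPoint_eq_average]
  refine Convex.set_average_mem C.convex C.isCompact.isClosed
    (Metric.measure_ball_pos _ _ one_pos).ne' measure_ball_lt_top.ne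
    (ae_restrict_of_ae ?_) (integrableOn_exposedPoint C)
  filter_upwards [ae_mem_exposingDirections_and_eq_gradient C] with l hl
  exact exposedPoint_mem hl.1

theorem edist_steinerPoint_le_demyanovDist (A B : ConvexBody E) :
    edist (steinerPoint A) (steinerPoint B) ≤ demyanovDist A B := by
  rcases eq_or_ne (demyanovDist A B) ⊤ with h | h
  · rw [h]; exact le_top
  have hv : 0 < volume.real (Metric.ball (0 : E) 1) :=
    ENNReal.toReal_pos (Metric.measure_ball_pos _ _ one_pos).ne' measure_ball_lt_top.ne
  rw [edist_dist, ← ENNReal.ofReal_toReal h]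
  refine ENNReal.ofReal_le_ofReal ?_
  rw [dist_eq_norm, steinerPoint_eq_average, steinerPoint_eq_average, setAverage_eq,
    setAverage_eq, ← smul_sub,
    ← integral_sub (integrableOn_exposedPoint A) (integrableOn_exposedPoint B), norm_smul,
    Real.norm_of_nonneg (inv_nonneg.mpr hv.le), inv_mul_le_iff₀ hv, mul_comm]
  refine norm_setIntegral_le_of_norm_le_const_ae measure_ball_lt_top (ae_restrict_of_ae ?_)
  filter_upwards [ae_mem_exposingDirections_and_eq_gradient A,
    ae_mem_exposingDirections_and_eq_gradient B] with l hA hB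
  rw [← dist_eq_norm, dist_edist]
  exact ENNReal.toReal_mono h (le_iSup₂_of_le l ⟨hA.1, hB.1⟩ le_rfl)

/-- The infimum defining the sharp constant is itself admissible: multiplication by a finite nonzero
distance commutes with infima. -/
theorem edist_steinerPoint_le_steinerLip (A B : ConvexBody E) :
    edist (steinerPoint A) (steinerPoint B) ≤ steinerLip E * edist A B := by
  rcases eq_or_ne A B with rfl | hAB
  · simp
  have h0 : edist A B ≠ 0 := edist_pos.mpr hAB |>.ne'
  rw [steinerLip, ENNReal.iInf_mul_of_ne h0 (edist_ne_top A B)]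
  refine le_iInf fun K => ?_
  rw [ENNReal.iInf_mul_of_ne h0 (edist_ne_top A B)]
  exact le_iInf fun hK => hK A B

end SteinerPoint

end AumannYoung

/-! ### Discrete sewing. -/

namespace AumannYoung

/-- Discrete sewing: an almost additive two-parameter function is close to the sum of its
increments. -/
theorem norm_sum_sub_le_of_almost_additive {V : Type*} [NormedAddCommGroup V] {p : ℕ → ℝ}
    (hp : Monotone p) {A : ℕ → ℕ → V} {K θ : ℝ} (hθ : 1 < θ) (h0 : ∀ i, A i i = 0)
    (hA : ∀ i j k, i ≤ j → j ≤ k → ‖A i k - A i j - A j k‖ ≤ K * (p k - p i) ^ θ)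
    (hK : 0 ≤ K) (a b : ℕ) (hab : a ≤ b) :
    ‖∑ j ∈ Finset.Ico a b, A j (j + 1) - A a b‖
      ≤ 2 * K / (1 - 2 ^ (1 - θ)) * (p b - p a) ^ θ := by
  set q : ℝ := 2 ^ (1 - θ) with hq
  have hq1 : q < 1 := Real.rpow_lt_one_of_one_lt_of_neg one_lt_two (by linarith)
  set c : ℝ := 2 * K / (1 - q) with hc
  have hc0 : 0 ≤ c := div_nonneg (by linarith) (by linarith)
  -- `c` is the fixed point of the recursion: each half contributes `c * q / 2`, and the two
  -- splittings cost `K` each.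
  have hcq : c * q + 2 * K = c := by
    have : 1 - q ≠ 0 := by linarith
    rw [hc]; field_simp; ring
  induction hn : b - a using Nat.strong_induction_on generalizing a b with
  | _ n ih =>
  rcases hab.eq_or_lt with rfl | hlt
  · simp only [Finset.Ico_self, Finset.sum_empty, h0, sub_self, norm_zero]
    exact mul_nonneg hc0 (Real.rpow_nonneg le_rfl _)
  have hL : 0 ≤ p b - p a := sub_nonneg.mpr (hp hab)
  -- `u` is the last index not beyond the midpoint. Setting aside the single step from `u` to `u +
  -- 1`, which straddles it, leaves two pieces of at most half the length.
  obtain ⟨u, hau, hub, hu, hv⟩ : ∃ u, a ≤ u ∧ u < b ∧ p u - p a ≤ (p b - p a) / 2 ∧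
      p b - p (u + 1) ≤ (p b - p a) / 2 := by
    classical
    have hs : (Finset.filter (fun u => p u - p a ≤ (p b - p a) / 2) (Finset.Ico a b)).Nonempty :=
      ⟨a, by simp [hlt]; linarith⟩
    obtain ⟨u, hu, hmax⟩ := Finset.exists_max_image _ id hs
    simp only [Finset.mem_filter, Finset.mem_Ico, id, and_imp] at hu hmax
    refine ⟨u, hu.1.1, hu.1.2, hu.2, ?_⟩
    by_contra! hcon
    have hne : u + 1 < b := by
      rcases (Nat.succ_le_of_lt hu.1.2).lt_or_eq with h | h
      · exact h
      · rw [Nat.succ_eq_add_one] at h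
        rw [h] at hcon; linarith
    have := hmax (u + 1) (by omega) hne (by linarith)
    omega
  have ih1 := ih (u - a) (by omega) a u hau rfl
  have ih2 := ih (b - (u + 1)) (by omega) (u + 1) b hub rfl
  have hhalf : ((p b - p a) / 2) ^ θ = q / 2 * (p b - p a) ^ θ := by
    rw [Real.div_rpow hL zero_le_two, hq, Real.rpow_sub two_pos, Real.rpow_one]
    ring
  have hθ0 : 0 ≤ θ := by linarith
  have e1 : c * (p u - p a) ^ θ ≤ c * (q / 2 * (p b - p a) ^ θ) := by
    rw [← hhalf]
    exact mul_le_mul_of_nonneg_left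
      (Real.rpow_le_rpow (sub_nonneg.mpr (hp hau)) hu hθ0) hc0
  have e2 : c * (p b - p (u + 1)) ^ θ ≤ c * (q / 2 * (p b - p a) ^ θ) := by
    rw [← hhalf]
    exact mul_le_mul_of_nonneg_left
      (Real.rpow_le_rpow (sub_nonneg.mpr (hp hub)) hv hθ0) hc0
  have e3 := hA a u b hau hub.le
  have e4 : ‖A u b - A u (u + 1) - A (u + 1) b‖ ≤ K * (p b - p a) ^ θ :=
    (hA u (u + 1) b (Nat.le_succ u) hub).trans <| mul_le_mul_of_nonneg_left
      (Real.rpow_le_rpow (sub_nonneg.mpr (hp hub.le))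
        (sub_le_sub_left (hp hau) _) hθ0) hK
  -- Splitting at `u` and then at `u + 1`: the term `A u (u + 1)` of the sum cancels exactly, so
  -- only two defects remain.
  have hsplit : ∑ j ∈ Finset.Ico a b, A j (j + 1) - A a b =
      (∑ j ∈ Finset.Ico a u, A j (j + 1) - A a u) +
      (∑ j ∈ Finset.Ico (u + 1) b, A j (j + 1) - A (u + 1) b) -
      (A a b - A a u - A u b) - (A u b - A u (u + 1) - A (u + 1) b) := by
    rw [← Finset.sum_Ico_consecutive _ hau hub.le, Finset.sum_eq_sum_Ico_succ_bot hub]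
    abel
  rw [hsplit]
  have hfin : c * (p b - p a) ^ θ = c * (q / 2 * (p b - p a) ^ θ) + c * (q / 2 * (p b - p a) ^ θ)
      + K * (p b - p a) ^ θ + K * (p b - p a) ^ θ := by
    nth_rewrite 1 [← hcq]; ring
  rw [hfin]
  refine (norm_sub_le _ _).trans (add_le_add ((norm_sub_le _ _).trans (add_le_add
    ((norm_add_le _ _).trans (add_le_add (ih1.trans e1) (ih2.trans e2))) e3)) e4)

/-! ### Matrix action and the Frobenius bound. -/

section Apply

variable {d e : ℕ}

theorem Mat.add_apply (A B : Mat e d) (v : EuclideanSpace ℝ (Fin d)) :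
    (A + B).apply v = A.apply v + B.apply v := by
  ext i
  simp [Mat.apply, Matrix.mulVec, dotProduct, add_mul, Finset.sum_add_distrib]

theorem Mat.smul_apply (c : ℝ) (A : Mat e d) (v : EuclideanSpace ℝ (Fin d)) :
    (c • A).apply v = c • A.apply v := by
  ext i
  simp [Mat.apply, Matrix.mulVec, dotProduct, Finset.mul_sum, mul_assoc]

theorem Mat.sub_apply (A B : Mat e d) (v : EuclideanSpace ℝ (Fin d)) :
    (A - B).apply v = A.apply v - B.apply v := by
  ext i
  simp [Mat.apply, Matrix.mulVec, dotProduct, sub_mul, Finset.sum_sub_distrib]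

theorem Mat.apply_sub (A : Mat e d) (v w : EuclideanSpace ℝ (Fin d)) :
    A.apply (v - w) = A.apply v - A.apply w := by
  ext i
  simp [Mat.apply, Matrix.mulVec, dotProduct, mul_sub, Finset.sum_sub_distrib]

theorem Mat.norm_apply_le (A : Mat e d) (v : EuclideanSpace ℝ (Fin d)) :
    ‖A.apply v‖ ≤ ‖A‖ * ‖v‖ := by
  refine (sq_le_sq₀ (norm_nonneg _) (by positivity)).mp ?_
  rw [mul_pow, EuclideanSpace.norm_sq_eq, EuclideanSpace.norm_sq_eq, EuclideanSpace.norm_sq_eq,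
    Fintype.sum_prod_type, Finset.sum_mul]
  refine Finset.sum_le_sum fun i _ => ?_
  simp only [Real.norm_eq_abs, sq_abs]
  exact Finset.sum_mul_sq_le_sq_mul_sq Finset.univ (fun j => A (i, j)) v.ofLp

theorem Mat.continuous_apply (v : EuclideanSpace ℝ (Fin d)) :
    Continuous fun A : Mat e d => A.apply v := by
  refine (LipschitzWith.of_dist_le_mul (K := ‖v‖₊) fun A B => ?_).continuous
  rw [dist_eq_norm, dist_eq_norm, ← Mat.sub_apply, mul_comm]
  exact Mat.norm_apply_le _ _

end Apply

/-! ### Dissections and their meshes. -/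

section Dissections

variable {T : ℝ}

theorem Dissection.gap_le_mesh (D : Dissection T) (k : Fin D.n) :
    (D.pts k.succ : ℝ) - D.pts k.castSucc ≤ D.mesh :=
  le_ciSup (f := fun k : Fin D.n => (D.pts k.succ : ℝ) - D.pts k.castSucc)
    (Set.finite_range _).bddAbove k

theorem Dissection.sum_gap (D : Dissection T) :
    ∑ k : Fin D.n, ((D.pts k.succ : ℝ) - D.pts k.castSucc) = T := by
  rw [Finset.sum_sub_distrib]
  have h1 := Fin.sum_univ_succ fun k => (D.pts k : ℝ)
  have h2 := Fin.sum_univ_castSucc fun k => (D.pts k : ℝ)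
  rw [D.first] at h1
  rw [D.last] at h2
  linarith

/-- One factor of each gap is kept, and these sum to `T`; the remaining power `θ - 1 > 0` is bounded
by the mesh. -/
theorem Dissection.sum_gap_rpow_le (D : Dissection T) {θ : ℝ} (hθ : 1 < θ) :
    ∑ k : Fin D.n, ((D.pts k.succ : ℝ) - D.pts k.castSucc) ^ θ ≤ T * D.mesh ^ (θ - 1) := by
  rw [← congrArg (· * D.mesh ^ (θ - 1)) D.sum_gap, Finset.sum_mul]
  refine Finset.sum_le_sum fun k _ => ?_
  have hk : 0 < (D.pts k.succ : ℝ) - D.pts k.castSucc :=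
    sub_pos.mpr (D.strictMono k.castSucc_lt_succ)
  calc _ = ((D.pts k.succ : ℝ) - D.pts k.castSucc) *
        ((D.pts k.succ : ℝ) - D.pts k.castSucc) ^ (θ - 1) := by
        rw [← Real.rpow_one_add' hk.le (by linarith)]; ring_nf
    _ ≤ _ := mul_le_mul_of_nonneg_left
        (Real.rpow_le_rpow hk.le (D.gap_le_mesh k) (by linarith)) hk.le

/-- The dissection of `[0, T]` into `n + 1` intervals of equal length. -/
noncomputable def uniformDissection (hT : 0 < T) (n : ℕ) : Dissection T where
  n := n + 1
  pts k := ⟨k / (n + 1 : ℝ) * T, by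
    have hk : ((k : ℕ) : ℝ) ≤ n + 1 := by exact_mod_cast Fin.is_le k
    exact ⟨by positivity, mul_le_of_le_one_left hT.le
      ((div_le_one (by positivity)).mpr hk)⟩⟩
  strictMono j k h := by
    have h' : ((j : ℕ) : ℝ) < (k : ℕ) := by exact_mod_cast h
    change (j : ℕ) / (n + 1 : ℝ) * T < (k : ℕ) / (n + 1 : ℝ) * T
    gcongr
  first := by simp
  last := by
    have : (n + 1 : ℝ) ≠ 0 := by positivity
    simp [this]

theorem mesh_uniformDissection (hT : 0 < T) (n : ℕ) :
    (uniformDissection hT n).mesh = T / (n + 1) := by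
  have : ∀ k : Fin (uniformDissection hT n).n,
      (((uniformDissection hT n).pts k.succ : ℝ) - (uniformDissection hT n).pts k.castSucc)
        = T / (n + 1) := fun k => by
    change ((k : ℕ) + 1 : ℕ) / (n + 1 : ℝ) * T - (k : ℕ) / (n + 1 : ℝ) * T = T / (n + 1)
    push_cast
    ring
  rw [Dissection.mesh]
  simp only [this]
  have : Nonempty (Fin (uniformDissection hT n).n) := inferInstanceAs (Nonempty (Fin (n + 1)))
  exact ciSup_const

/-- Needed for limits along the mesh to be unique; uniform dissections witness it. -/
theorem meshFilter_neBot (hT : 0 < T) : (meshFilter T).NeBot := by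
  have h : Tendsto (uniformDissection hT) atTop (meshFilter T) := by
    rw [meshFilter, tendsto_comap_iff]
    have : Dissection.mesh ∘ uniformDissection hT = fun n : ℕ => T / ((n : ℝ) + 1) :=
      funext (mesh_uniformDissection hT)
    rw [this]
    exact tendsto_const_div_atTop_nhds_zero_nat T |>.comp (tendsto_add_atTop_nat 1) |>.congr
      fun n => by simp
  exact h.neBot

end Dissections

/-! ### Existence of the Young integral, with a uniform error bound. -/

section Young

variable {d e : ℕ} {T : ℝ}

/-- If `p` refines the dissection `D` along `σ`, the Riemann sum of `D` is close to that of `p`. -/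
theorem norm_sum_sub_sum_le {V : Type*} [NormedAddCommGroup V]
    {A : Icc (0 : ℝ) T → Icc (0 : ℝ) T → V}
    {K θ : ℝ} (hθ : 1 < θ) (h0 : ∀ s, A s s = 0)
    (hA : ∀ s u t, s ≤ u → u ≤ t → ‖A s t - A s u - A u t‖ ≤ K * ((t : ℝ) - s) ^ θ)
    (hK : 0 ≤ K) (D : Dissection T) {p : ℕ → Icc (0 : ℝ) T} (hp : Monotone p)
    {σ : Fin (D.n + 1) → ℕ} (hσ : Monotone σ) (hpσ : ∀ k, p (σ k) = D.pts k) :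
    ‖∑ j ∈ Finset.Ico (σ 0) (σ (Fin.last D.n)), A (p j) (p (j + 1)) -
      ∑ k : Fin D.n, A (D.pts k.castSucc) (D.pts k.succ)‖
      ≤ 2 * K / (1 - 2 ^ (1 - θ)) * (T * D.mesh ^ (θ - 1)) := by
  -- The refined sum is cut into blocks, one per interval of `D`; sewing is then applied to each
  -- block.
  have hsum : ∀ (n : ℕ) (τ : Fin (n + 1) → ℕ), Monotone τ →
      ∑ j ∈ Finset.Ico (τ 0) (τ (Fin.last n)), A (p j) (p (j + 1)) =
      ∑ k : Fin n, ∑ j ∈ Finset.Ico (τ k.castSucc) (τ k.succ), A (p j) (p (j + 1)) := by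
    intro n
    induction n with
    | zero => intro τ _; simp
    | succ n ih =>
      intro τ hτ
      rw [Fin.sum_univ_castSucc, ← Finset.sum_Ico_consecutive _ (hτ (Fin.zero_le (Fin.last n).castSucc))
        (hτ (Fin.le_last _))]
      have := ih (fun k => τ k.castSucc) (hτ.comp (Fin.strictMono_castSucc.monotone))
      simp only [Fin.castSucc_zero] at this
      rw [this]
      simp
  have hq1 : (2 : ℝ) ^ (1 - θ) < 1 := Real.rpow_lt_one_of_one_lt_of_neg one_lt_two (by linarith)
  rw [hsum _ _ hσ, ← Finset.sum_sub_distrib]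
  refine (norm_sum_le _ _).trans ?_
  refine le_trans (Finset.sum_le_sum fun k _ => ?_) (le_trans (le_of_eq
    (Finset.mul_sum Finset.univ _ (2 * K / (1 - 2 ^ (1 - θ)))).symm) (mul_le_mul_of_nonneg_left
    (D.sum_gap_rpow_le hθ) (div_nonneg (by linarith) (by linarith))))
  have := norm_sum_sub_le_of_almost_additive (p := fun i => (p i : ℝ)) (fun i j h => hp h)
    (A := fun i j => A (p i) (p j)) hθ (fun i => h0 _)
    (fun i j k hij hjk => hA _ _ _ (hp hij) (hp hjk)) hK _ _ (hσ k.castSucc_le_succ)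
  simpa only [hpσ] using this

theorem exists_common_refinement (D D' : Dissection T) :
    ∃ (p : ℕ → Icc (0 : ℝ) T) (σ : Fin (D.n + 1) → ℕ) (σ' : Fin (D'.n + 1) → ℕ),
      Monotone p ∧ Monotone σ ∧ Monotone σ' ∧ (∀ k, p (σ k) = D.pts k) ∧
      (∀ k, p (σ' k) = D'.pts k) ∧ σ 0 = σ' 0 ∧ σ (Fin.last _) = σ' (Fin.last _) := by
  classical
  set P : Finset (Icc (0 : ℝ) T) := Finset.univ.image D.pts ∪ Finset.univ.image D'.pts with hP
  have hD : ∀ k, D.pts k ∈ P := fun k =>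
    Finset.mem_union_left _ (Finset.mem_image_of_mem _ (Finset.mem_univ k))
  have hD' : ∀ k, D'.pts k ∈ P := fun k =>
    Finset.mem_union_right _ (Finset.mem_image_of_mem _ (Finset.mem_univ k))
  have hcard : 0 < P.card := Finset.card_pos.mpr ⟨_, hD 0⟩
  let φ := P.orderIsoOfFin rfl
  -- `p` enumerates the union of the two point sets in increasing order; clamping the index makes it
  -- constant past the last point.
  refine ⟨fun i => φ ⟨min i (P.card - 1), by omega⟩, fun k => φ.symm ⟨D.pts k, hD k⟩,
    fun k => φ.symm ⟨D'.pts k, hD' k⟩, ?_, ?_, ?_, ?_, ?_, ?_, ?_⟩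
  · intro i j hij
    refine φ.monotone ?_
    rw [Fin.mk_le_mk]
    exact min_le_min_right _ hij
  · intro i j hij
    exact φ.symm.monotone (D.strictMono.monotone hij)
  · intro i j hij
    exact φ.symm.monotone (D'.strictMono.monotone hij)
  · intro k
    have : (⟨min (φ.symm ⟨D.pts k, hD k⟩ : ℕ) (P.card - 1), by omega⟩ : Fin P.card) =
      φ.symm ⟨D.pts k, hD k⟩ := Fin.ext (min_eq_left (by omega))
    simp only [this, OrderIso.apply_symm_apply]
  · intro k
    have : (⟨min (φ.symm ⟨D'.pts k, hD' k⟩ : ℕ) (P.card - 1), by omega⟩ : Fin P.card) =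
      φ.symm ⟨D'.pts k, hD' k⟩ := Fin.ext (min_eq_left (by omega))
    simp only [this, OrderIso.apply_symm_apply]
  · have : D.pts 0 = D'.pts 0 := Subtype.ext (D.first.trans D'.first.symm)
    simp only [this]
  · have : D.pts (Fin.last _) = D'.pts (Fin.last _) := Subtype.ext (D.last.trans D'.last.symm)
    simp only [this]

/-- Both sums are compared with a common refinement. The additivity defect is `(f s - f u)(w t - w
u)`, of order `α + β > 1`. -/
theorem norm_riemannSum_sub_le {α β r M : ℝ≥0} (hαβ : 1 < α + β)
    {f : Icc (0 : ℝ) T → Mat e d} {w : Icc (0 : ℝ) T → EuclideanSpace ℝ (Fin d)}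
    (hf : HolderWith r α f) (hw : HolderWith M β w) (D D' : Dissection T) :
    ‖riemannSum f w D - riemannSum f w D'‖ ≤
      2 * (r * M) / (1 - 2 ^ (1 - (α + β : ℝ))) * (T * D.mesh ^ (α + β - 1 : ℝ)) +
      2 * (r * M) / (1 - 2 ^ (1 - (α + β : ℝ))) * (T * D'.mesh ^ (α + β - 1 : ℝ)) := by
  have hθ : (1 : ℝ) < α + β := by exact_mod_cast hαβ
  let A : Icc (0 : ℝ) T → Icc (0 : ℝ) T → EuclideanSpace ℝ (Fin e) :=
    fun s t => (f s).apply (w t - w s)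
  have h0 : ∀ s, A s s = 0 := fun s => by simp only [A, Mat.apply_sub, sub_self]
  have hA : ∀ s u t, s ≤ u → u ≤ t →
      ‖A s t - A s u - A u t‖ ≤ (r * M : ℝ) * ((t : ℝ) - s) ^ (α + β : ℝ) := by
    intro s u t hsu hut
    have heq : A s t - A s u - A u t = (f s - f u).apply (w t - w u) := by
      simp only [A, Mat.apply_sub, Mat.sub_apply]
      abel
    have hsu' : (s : ℝ) ≤ u := hsu
    have hut' : (u : ℝ) ≤ t := hut
    have h1 : ‖f s - f u‖ ≤ r * ((t : ℝ) - s) ^ (α : ℝ) := by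
      rw [← dist_eq_norm]
      refine hf.dist_le_of_le ?_
      rw [Subtype.dist_eq, Real.dist_eq, abs_sub_comm, abs_of_nonneg (by linarith)]
      linarith
    have h2 : ‖w t - w u‖ ≤ M * ((t : ℝ) - s) ^ (β : ℝ) := by
      rw [← dist_eq_norm]
      refine hw.dist_le_of_le ?_
      rw [Subtype.dist_eq, Real.dist_eq, abs_of_nonneg (by linarith)]
      linarith
    rw [heq, Real.rpow_add_of_nonneg (by linarith : 0 ≤ (t : ℝ) - s) α.coe_nonneg β.coe_nonneg]
    calc _ ≤ ‖f s - f u‖ * ‖w t - w u‖ := Mat.norm_apply_le _ _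
      _ ≤ (r * ((t : ℝ) - s) ^ (α : ℝ)) * (M * ((t : ℝ) - s) ^ (β : ℝ)) :=
        mul_le_mul h1 h2 (norm_nonneg _) ((norm_nonneg _).trans h1)
      _ = _ := by ring
  obtain ⟨p, σ, σ', hp, hσ, hσ', hpσ, hpσ', hfirst, hlast⟩ := exists_common_refinement D D'
  have hK : (0 : ℝ) ≤ r * M := by positivity
  have e1 := norm_sum_sub_sum_le hθ h0 hA hK D hp hσ hpσ
  have e2 := norm_sum_sub_sum_le hθ h0 hA hK D' hp hσ' hpσ'
  rw [← hfirst, ← hlast] at e2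
  rw [norm_sub_rev] at e1
  exact (norm_sub_le_norm_sub_add_norm_sub _ _ _).trans (add_le_add e1 e2)

theorem tendsto_meshFilter_rpow {θ : ℝ} (hθ : 0 < θ) (c : ℝ) :
    Tendsto (fun D : Dissection T => c * (T * D.mesh ^ θ)) (meshFilter T) (𝓝 0) := by
  have h : Tendsto (Dissection.mesh : Dissection T → ℝ) (meshFilter T) (𝓝 0) := tendsto_comap
  have h' := ((h.rpow_const (Or.inr hθ.le)).const_mul T).const_mul c
  simpa [Real.zero_rpow hθ.ne'] using h'

theorem tendsto_riemannSum_youngIntegral (hT : 0 < T) {α β r M : ℝ≥0} (hαβ : 1 < α + β)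
    {f : Icc (0 : ℝ) T → Mat e d} {w : Icc (0 : ℝ) T → EuclideanSpace ℝ (Fin d)}
    (hf : HolderWith r α f) (hw : HolderWith M β w) :
    Tendsto (riemannSum f w) (meshFilter T) (𝓝 (youngIntegral f w)) := by
  have := meshFilter_neBot hT
  have hθ : (0 : ℝ) < α + β - 1 := by
    have : (1 : ℝ) < α + β := by exact_mod_cast hαβ
    linarith
  refine tendsto_nhds_limUnder (CompleteSpace.complete (Metric.cauchy_iff.mpr
    ⟨inferInstance, fun ε hε => ?_⟩))
  have hev := (tendsto_meshFilter_rpow (T := T) hθ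
    (2 * (r * M) / (1 - 2 ^ (1 - (α + β : ℝ))))).eventually (gt_mem_nhds (half_pos hε))
  refine ⟨_, image_mem_map hev, ?_⟩
  rintro _ ⟨D, hD, rfl⟩ _ ⟨D', hD', rfl⟩
  rw [dist_eq_norm]
  have := norm_riemannSum_sub_le hαβ hf hw D D'
  simp only [mem_ofPred_eq] at hD hD'
  linarith

/-- The Cauchy estimate with one dissection fixed, as the mesh of the other tends to `0`. -/
theorem norm_youngIntegral_sub_riemannSum_le (hT : 0 < T) {α β r M : ℝ≥0} (hαβ : 1 < α + β)
    {f : Icc (0 : ℝ) T → Mat e d} {w : Icc (0 : ℝ) T → EuclideanSpace ℝ (Fin d)}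
    (hf : HolderWith r α f) (hw : HolderWith M β w) (D : Dissection T) :
    ‖youngIntegral f w - riemannSum f w D‖ ≤
      2 * (r * M) / (1 - 2 ^ (1 - (α + β : ℝ))) * (T * D.mesh ^ (α + β - 1 : ℝ)) := by
  have := meshFilter_neBot hT
  have hθ : (0 : ℝ) < α + β - 1 := by
    have : (1 : ℝ) < α + β := by exact_mod_cast hαβ
    linarith
  have h1 := ((tendsto_riemannSum_youngIntegral hT hαβ hf hw).sub_const (riemannSum f w D)).norm
  have h2 := (tendsto_meshFilter_rpow (T := T) hθ
    (2 * (r * M) / (1 - 2 ^ (1 - (α + β : ℝ))))).add_const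
    (2 * (r * M) / (1 - 2 ^ (1 - (α + β : ℝ))) * (T * D.mesh ^ (α + β - 1 : ℝ)))
  rw [zero_add] at h2
  exact le_of_tendsto_of_tendsto' h1 h2 fun D' => norm_riemannSum_sub_le hαβ hf hw D' D

theorem riemannSum_add (f g : Icc (0 : ℝ) T → Mat e d)
    (w : Icc (0 : ℝ) T → EuclideanSpace ℝ (Fin d)) (D : Dissection T) :
    riemannSum (f + g) w D = riemannSum f w D + riemannSum g w D := by
  simp only [riemannSum, Pi.add_apply, Mat.add_apply, Finset.sum_add_distrib]

theorem riemannSum_smul (c : ℝ) (f : Icc (0 : ℝ) T → Mat e d)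
    (w : Icc (0 : ℝ) T → EuclideanSpace ℝ (Fin d)) (D : Dissection T) :
    riemannSum (c • f) w D = c • riemannSum f w D := by
  simp only [riemannSum, Pi.smul_apply, Mat.smul_apply, Finset.smul_sum]

theorem continuous_riemannSum (w : Icc (0 : ℝ) T → EuclideanSpace ℝ (Fin d)) (D : Dissection T) :
    Continuous fun f : Icc (0 : ℝ) T → Mat e d => riemannSum f w D :=
  continuous_finsetSum _ fun _ _ => (Mat.continuous_apply _).comp (_root_.continuous_apply _)

end Young

end AumannYoung

namespace AumannYoung

theorem holderWith_iff_eHolderNorm_le {X Y : Type*} [MetricSpace X] [MetricSpace Y] {r α : ℝ≥0}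
    {f : X → Y} : eHolderNorm α f ≤ (r : ℝ≥0∞) ↔ HolderWith r α f := by
  refine ⟨fun h s t => ?_, HolderWith.eHolderNorm_le⟩
  have hm : MemHolder α f := eHolderNorm_lt_top.mp (h.trans_lt ENNReal.coe_lt_top)
  refine (hm.holderWith s t).trans ?_
  rw [hm.coe_nnHolderNorm_eq_eHolderNorm]
  gcongr

/-! ### The set of selections: Steiner selection, compactness, convexity. -/

section Selections

variable {d e : ℕ} {T : ℝ}

theorem edist_rpow_of_lt {α : ℝ≥0} {s t : Icc (0 : ℝ) T} (h : s < t) :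
    edist s t ^ (α : ℝ) = ENNReal.ofReal (((t : ℝ) - s) ^ (α : ℝ)) := by
  have h' : (0 : ℝ) < (t : ℝ) - s := sub_pos.mpr h
  rw [edist_dist, Subtype.dist_eq, Real.dist_eq, abs_sub_comm, abs_of_pos h',
    ENNReal.ofReal_rpow_of_pos h']

theorem holderWith_steinerPoint {α r : ℝ≥0} {F : Icc (0 : ℝ) T → ConvexBody (Mat e d)}
    (hF : MemHolder α F) (hr : rMin α F ≤ (r : ℝ≥0∞)) :
    HolderWith r α fun t => steinerPoint (F t) := by
  rcases min_le_iff.mp hr with h | h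
  · intro s t
    calc edist (steinerPoint (F s)) (steinerPoint (F t))
        ≤ steinerLip (Mat e d) * edist (F s) (F t) := edist_steinerPoint_le_steinerLip _ _
      _ ≤ steinerLip (Mat e d) * (eHolderNorm α F * edist s t ^ (α : ℝ)) := by
        gcongr
        rw [← hF.coe_nnHolderNorm_eq_eHolderNorm]
        exact hF.holderWith s t
      _ ≤ r * edist s t ^ (α : ℝ) := by
        rw [← mul_assoc]
        gcongr
  · have hlt : ∀ s t : Icc (0 : ℝ) T, s < t →
        edist (steinerPoint (F s)) (steinerPoint (F t)) ≤ r * edist s t ^ (α : ℝ) := by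
      intro s t hst
      have hpos : 0 < ((t : ℝ) - s) ^ (α : ℝ) := Real.rpow_pos_of_pos (sub_pos.mpr hst) _
      rw [edist_rpow_of_lt hst]
      refine (edist_steinerPoint_le_demyanovDist _ _).trans ?_
      rw [← ENNReal.div_le_iff (ENNReal.ofReal_pos.mpr hpos).ne' ENNReal.ofReal_ne_top]
      refine le_trans ?_ h
      rw [demyanovHolderSeminorm]
      refine le_iSup_of_le s ?_
      exact le_iSup₂_of_le (f := fun (t : Icc (0 : ℝ) T) (_ : s < t) =>
        demyanovDist (F s) (F t) / ENNReal.ofReal (((t : ℝ) - s) ^ (α : ℝ))) t hst le_rfl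
    intro s t
    rcases lt_trichotomy s t with hst | rfl | hst
    · exact hlt s t hst
    · simp
    · rw [edist_comm, edist_comm s]
      exact hlt t s hst

/-- Measurability is automatic, since a Hölder map of positive exponent is continuous. -/
theorem mem_selections_iff {α r : ℝ≥0} (hα : 0 < α) {F : Icc (0 : ℝ) T → ConvexBody (Mat e d)}
    {f : Icc (0 : ℝ) T → Mat e d} :
    f ∈ selections α r F ↔ (∀ t, f t ∈ F t) ∧ HolderWith r α f := by
  refine ⟨fun h => ⟨h.2.1, holderWith_iff_eHolderNorm_le.mp h.2.2⟩, fun h =>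
    ⟨(h.2.continuous hα).measurable, h.1, holderWith_iff_eHolderNorm_le.mpr h.2⟩⟩

theorem isCompact_selections {α r : ℝ≥0} (hα : 0 < α)
    (F : Icc (0 : ℝ) T → ConvexBody (Mat e d)) : IsCompact (selections α r F) := by
  have heq : selections α r F = (univ.pi fun t => (F t : Set (Mat e d))) ∩
      {f | ∀ s t, edist (f s) (f t) ≤ r * edist s t ^ (α : ℝ)} := by
    ext f
    rw [mem_selections_iff hα, mem_inter_iff, mem_univ_pi]
    rfl
  rw [heq]
  refine (isCompact_univ_pi fun t => (F t).isCompact).inter_right ?_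
  simp only [ofPred_forall]
  exact isClosed_iInter fun s => isClosed_iInter fun t => isClosed_le (by fun_prop) (by fun_prop)

theorem convex_selections {α r : ℝ≥0} (hα : 0 < α)
    (F : Icc (0 : ℝ) T → ConvexBody (Mat e d)) : Convex ℝ (selections α r F) := by
  intro f hf g hg a b ha hb hab
  rw [mem_selections_iff hα] at *
  refine ⟨fun t => (F t).convex (hf.1 t) (hg.1 t) ha hb hab, fun s t => ?_⟩
  have h1 := hf.2.dist_le s t
  have h2 := hg.2.dist_le s t
  have key : dist ((a • f + b • g) s) ((a • f + b • g) t) ≤ r * dist s t ^ (α : ℝ) := by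
    rw [dist_eq_norm] at h1 h2 ⊢
    have : (a • f + b • g) s - (a • f + b • g) t = a • (f s - f t) + b • (g s - g t) := by
      simp only [Pi.add_apply, Pi.smul_apply]
      module
    rw [this]
    calc _ ≤ a * ‖f s - f t‖ + b * ‖g s - g t‖ := by
          refine (norm_add_le _ _).trans_eq ?_
          rw [norm_smul, norm_smul, Real.norm_of_nonneg ha, Real.norm_of_nonneg hb]
      _ ≤ a * (r * dist s t ^ (α : ℝ)) + b * (r * dist s t ^ (α : ℝ)) := by gcongr
      _ = _ := by rw [← add_mul, hab, one_mul]
  rw [edist_dist, edist_dist s, ENNReal.ofReal_rpow_of_nonneg dist_nonneg α.coe_nonneg,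
    ← ENNReal.ofReal_coe_nnreal, ← ENNReal.ofReal_mul r.coe_nonneg]
  exact ENNReal.ofReal_le_ofReal key

end Selections

/-! ### Continuity and linearity of the integral on selections. -/

section Integral

variable {d e : ℕ} {T : ℝ}

theorem aumannYoungIntegral_eq_image (α r : ℝ≥0) (F : Icc (0 : ℝ) T → ConvexBody (Mat e d))
    (w : Icc (0 : ℝ) T → EuclideanSpace ℝ (Fin d)) :
    aumannYoungIntegral α r F w = (fun f => youngIntegral f w) '' selections α r F := by
  ext j
  simp only [aumannYoungIntegral, mem_image, eq_comm]
  rfl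

theorem continuousOn_youngIntegral (hT : 0 < T) {α β r M : ℝ≥0} (hα : 0 < α)
    (hαβ : 1 < α + β) (F : Icc (0 : ℝ) T → ConvexBody (Mat e d))
    {w : Icc (0 : ℝ) T → EuclideanSpace ℝ (Fin d)} (hw : HolderWith M β w) :
    ContinuousOn (fun f => youngIntegral f w) (selections α r F) := by
  have := meshFilter_neBot hT
  have hθ : (0 : ℝ) < α + β - 1 := by
    have : (1 : ℝ) < α + β := by exact_mod_cast hαβ
    linarith
  have hu : TendstoUniformlyOn (fun D f => riemannSum f w D) (fun f => youngIntegral f w)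
      (meshFilter T) (selections α r F) := by
    rw [Metric.tendstoUniformlyOn_iff]
    intro ε hε
    filter_upwards [(tendsto_meshFilter_rpow (T := T) hθ
      (2 * (r * M) / (1 - 2 ^ (1 - (α + β : ℝ))))).eventually (gt_mem_nhds hε)] with D hD f hf
    rw [dist_eq_norm]
    exact (norm_youngIntegral_sub_riemannSum_le hT hαβ ((mem_selections_iff hα).mp hf).2 hw
      D).trans_lt hD
  exact hu.continuousOn (Frequently.of_forall fun D => (continuous_riemannSum w D).continuousOn)

theorem youngIntegral_smul_add_smul (hT : 0 < T) {α β r r' M : ℝ≥0} (hαβ : 1 < α + β)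
    {f g : Icc (0 : ℝ) T → Mat e d} {w : Icc (0 : ℝ) T → EuclideanSpace ℝ (Fin d)}
    (hf : HolderWith r α f) (hg : HolderWith r' α g) (hw : HolderWith M β w) (a b : ℝ) :
    youngIntegral (a • f + b • g) w = a • youngIntegral f w + b • youngIntegral g w := by
  have := meshFilter_neBot hT
  refine Tendsto.limUnder_eq ?_
  refine (((tendsto_riemannSum_youngIntegral hT hαβ hf hw).const_smul a).add
    ((tendsto_riemannSum_youngIntegral hT hαβ hg hw).const_smul b)).congr fun D => ?_
  rw [riemannSum_add, riemannSum_smul, riemannSum_smul]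

end Integral

end AumannYoung

theorem mainTheorem4 (d e : ℕ) (hd : 1 ≤ d) (he : 1 ≤ e) (T : ℝ) (hT : 0 < T)
    (α β : ℝ≥0) (hα : 0 < α) (hα1 : α ≤ 1) (hβ : 0 < β) (hβ1 : β ≤ 1) (hαβ : 1 < α + β)
    (F : Icc (0 : ℝ) T → ConvexBody (AumannYoung.Mat e d)) (hF : MemHolder α F)
    (w : Icc (0 : ℝ) T → EuclideanSpace ℝ (Fin d)) (hw : MemHolder β w)
    (r : ℝ≥0) (hr : AumannYoung.rMin α F ≤ (r : ℝ≥0∞)) :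
    (∀ f ∈ AumannYoung.selections α r F,
      Tendsto (AumannYoung.riemannSum f w) (AumannYoung.meshFilter T)
        (𝓝 (AumannYoung.youngIntegral f w))) ∧
    (AumannYoung.aumannYoungIntegral α r F w).Nonempty ∧
    Bornology.IsBounded (AumannYoung.aumannYoungIntegral α r F w) ∧
    IsClosed (AumannYoung.aumannYoungIntegral α r F w) ∧
    Convex ℝ (AumannYoung.aumannYoungIntegral α r F w) := by
  obtain ⟨M, hM⟩ := hw
  have hcompact : IsCompact (AumannYoung.aumannYoungIntegral α r F w) := by
    rw [AumannYoung.aumannYoungIntegral_eq_image]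
    exact (AumannYoung.isCompact_selections hα F).image_of_continuousOn
      (AumannYoung.continuousOn_youngIntegral hT hα hαβ F hM)
  refine ⟨fun f hf => AumannYoung.tendsto_riemannSum_youngIntegral hT hαβ
    ((AumannYoung.mem_selections_iff hα).mp hf).2 hM, ?_, hcompact.isBounded,
    hcompact.isClosed, ?_⟩
  · exact ⟨_, fun t => AumannYoung.steinerPoint (F t), (AumannYoung.mem_selections_iff hα).mpr
      ⟨fun t => AumannYoung.steinerPoint_mem (F t), AumannYoung.holderWith_steinerPoint hF hr⟩, rfl⟩
  · rintro _ ⟨f, hf, rfl⟩ _ ⟨g, hg, rfl⟩ a b ha hb hab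
    exact ⟨a • f + b • g, AumannYoung.convex_selections hα F hf hg ha hb hab,
      (AumannYoung.youngIntegral_smul_add_smul hT hαβ ((AumannYoung.mem_selections_iff hα).mp hf).2
        ((AumannYoung.mem_selections_iff hα).mp hg).2 hM a b).symm⟩
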